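/- **Setting.** Let $G=(V,E)$ be an undirected simple graph with $n=|V|$ vertices, let $\beta\in(0,1)$ and $\varepsilon>0$, and let $L,\rho\in\mathbb N$. A collection $W$ of ($\beta$-)shorted walks of length $L$ and overhead $\rho$ on $G$ is the following random object. (1) A random terminal set $T\subseteq V$ contains each vertex $v$ independently with some probability $p_v$, where $\beta\le p_v\le 1$. (2) Given $T$, for each edge $e\in E$ and each of the two endpoints of $e$, run $\rho$ independent simple random walks in $G$ starting at that endpoint, each stopped as soon as it is at a vertex of $T$ or has made $L$ steps. All these walks are independent given $T$. The load of an edge $e$ with respect to $W$ is the number of walks in $W$ that pass through $e$. Here $\log$ is the natural logarithm. **Theorem.** For constants $c,R>0$, call $(G,\beta,\varepsilon,(p_v),\rho)$ *$(c,R)$-admissible* if it is as above and $\beta n\ge c\log n$ and $\rho\le R\,\varepsilon^{-2}\log n$ (i.e. $\beta n=\Omega(\log n)$ and $\rho=O(\varepsilon^{-2}\log n)$). 1. For all constants $c,\delta,a,R>0$ there is a constant $K>0$, depending only on these, such that for every $(c,R)$-admissible $(G,\beta,\varepsilon,(p_v),\rho)$ and every $L\ge K\beta^{-3}\log^4 n$: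 each walk of $W$ has the property (P) if the connected component of its starting vertex contains a vertex of $T$, then the walk terminates at a vertex of $T$ with probability at least $1-n^{-\delta}$; and if moreover $\varepsilon\ge n^{-a}$, then with probability at least $1-n^{-\delta}$ all walks of $W$ have property (P) simultaneously. 2. For all constants $c,K,R>0$ there is a constant $C>0$, depending only on these, such that for every $(c,R)$-admissible $(G,\beta,\varepsilon,(p_v),\rho)$ and every $L\le K\beta^{-3}\log^4 n$, the expected load of every edge $e\in E$ with respect to $W$ is at most $C\,\beta^{-3}\,\varepsilon^{-2}\log^5 n$. In particular, for a suitable $L=\Theta(\beta^{-3}\log^4 n)$ both conclusions hold for the same collection $W$. -/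

import Mathlib

open MeasureTheory
open scoped ENNReal

universe u

/-- Number of vertices `n` of a finite vertex type, as a real number. -/
noncomputable def numVerts (V : Type*) [Fintype V] : ℝ := (Fintype.card V : ℝ)

/-- The probability that a random vertex set, which contains each vertex `v` independently with
probability `p v`, is equal to `S`. -/
noncomputable def terminalWeight {V : Type*} [Fintype V] [DecidableEq V]
    (p : V → ℝ) (S : Finset V) : ℝ≥0∞ :=
  ENNReal.ofReal (∏ v, if v ∈ S then p v else 1 - p v)

/-- Finite walks in `G` that start at `u`: pairs of an end vertex and a walk from `u` to it. -/
abbrev WalkFrom {V : Type*} (G : SimpleGraph V) (u : V) : Type _ := Σ v : V, G.Walk u v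

/-- The discrete σ-algebra on the set of walks between two given vertices. -/
instance walkMeasurableSpace {V : Type*} (G : SimpleGraph V) (u v : V) :
    MeasurableSpace (G.Walk u v) := ⊤

open Classical in
/-- The simple random walk from `u`, stopped as soon as it is at a vertex of `S` or has made `L`
steps. Each step goes to a uniformly random neighbour of the current vertex. (A walk at an isolated
vertex stays there; this never happens to a walk that starts at an endpoint of an edge.) -/
noncomputable def stoppedWalk {V : Type*} [Fintype V]
    (G : SimpleGraph V) [DecidableRel G.Adj] (S : Finset V) :
    ℕ → (u : V) → PMF (WalkFrom G u)
  | 0, u => PMF.pure ⟨u, SimpleGraph.Walk.nil⟩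
  | L + 1, u =>
      if u ∈ S then PMF.pure ⟨u, SimpleGraph.Walk.nil⟩
      else if h : Nonempty (G.neighborSet u) then
        haveI := h
        (PMF.uniformOfFintype (G.neighborSet u)).bind fun v =>
          (stoppedWalk G S L v.1).map fun w => ⟨w.1, SimpleGraph.Walk.cons v.2 w.2⟩
      else PMF.pure ⟨u, SimpleGraph.Walk.nil⟩

/-- Indices of the walks of the collection: an edge together with one of its two endpoints (that
is, a dart `d`, the endpoint being `d.fst`), and a number below the sampling overhead `ρ`. -/
abbrev WalkIndex {V : Type*} (G : SimpleGraph V) (ρ : ℕ) : Type _ := G.Dart × Fin ρ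

/-- The vertex at which the walk with index `i` starts. -/
abbrev WalkIndex.start {V : Type*} {G : SimpleGraph V} {ρ : ℕ} (i : WalkIndex G ρ) : V := i.1.fst

/-- Outcomes of the sampling: a terminal set and a walk for every index. -/
abbrev WalkCollection {V : Type*} (G : SimpleGraph V) (ρ : ℕ) : Type _ :=
  Finset V × ((i : WalkIndex G ρ) → WalkFrom G i.start)

/-- The joint law of the terminal set and the collection of shorted walks: every vertex `v` is a
terminal independently with probability `p v`; given the terminal set `S`, for every edge and each
of its endpoints, `ρ` independent random walks from that endpoint are run until they reach `S` or
have made `L` steps. -/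
noncomputable def shortedWalksLaw {V : Type*} [Fintype V] [DecidableEq V]
    (G : SimpleGraph V) [DecidableRel G.Adj] (p : V → ℝ) (L ρ : ℕ) :
    Measure (WalkCollection G ρ) :=
  ∑ S : Finset V, terminalWeight p S •
    (Measure.dirac S).prod
      (Measure.pi fun i : WalkIndex G ρ => (stoppedWalk G S L i.start).toMeasure)

/-- If the connected component of the start of walk `i` contains a terminal, then walk `i`
terminates at a terminal. -/
def EndsAtTerminal {V : Type*} {G : SimpleGraph V} {ρ : ℕ} (x : WalkCollection G ρ)
    (i : WalkIndex G ρ) : Prop :=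
  (∃ t ∈ x.1, G.Reachable i.start t) → (x.2 i).1 ∈ x.1

open Classical in
/-- The load of the edge `e`: the number of walks in the collection that pass through `e`. -/
noncomputable def load {V : Type*} [Fintype V] {G : SimpleGraph V} [DecidableRel G.Adj] {ρ : ℕ}
    (x : WalkCollection G ρ) (e : Sym2 V) : ℕ :=
  (Finset.univ.filter fun i : WalkIndex G ρ => e ∈ (x.2 i).2.edges).card

/-!
The first part averages over the terminal set before looking at it: a walk fails only if it sees
fewer than `min N #C` vertices, `C` being the component of its start, or if it sees `N` vertices
none of which is a terminal (`shortedWalksLaw_not_endsAtTerminal_le`). For `N` of order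
`log n / β` the second event has probability at most `(1 - β) ^ N`. The first is controlled by the
theorem of Barnes and Feige that a walk in a component with at least `N` vertices sees `N` vertices
in expected time `O(N ^ 3)` (`reward_one_le`), whatever its start. Markov's inequality and
`O(log n)` independent repetitions then make the failure probability polynomially small
(`fewProb_le_half_pow`), and a union bound over the walks gives the simultaneous statement.

For the bound `2 * N ^ 3` it is enough that every vertex `w`, once reached, is visited at most
`2 * N ^ 2` times before `N` vertices are seen, because fewer than `N` vertices are reached until
then (`reward_compl_le`).
* If `deg w ≥ 2 * N`, then each visit to `w` finds a new vertex in the next step with probability at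
  least `1 / 2` (`reward_single_le_of_two_mul_le_degree`).
* If `deg w < 2 * N`, take a subtree with `N` vertices that contains `w`. All its vertices have been
  seen once the walk has followed the closed tour around the tree, hitting one vertex of the tour
  after the other. In a round trip between the ends `x`, `y` of an edge, the expected number of
  visits to `w` is `deg w` times the effective resistance between `x` and `y`, hence at most `deg w`
  (`hitVisits_add_hitVisits_le`). The whole tour therefore costs at most `N * deg w` visits
  (`reward_single_self_le_degree`).
The numbers of visits are never computed as expectations; they are bounded by solutions of the
Poisson equation of the graph Laplacian, by induction on the number of steps.

The second part is stationarity: `deg u` walks from every vertex `u` cross an edge at most twice per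
step in expectation, and stopping only removes crossings (`sum_degree_mul_crossing_le`). The
expected load is thus at most `2 * ρ * L` (`lintegral_load_le`).
-/

namespace ShortedWalks

open Finset Matrix

section

variable {V : Type*} [Fintype V] (G : SimpleGraph V) [DecidableRel G.Adj]

/-! ### Averaging over neighbours -/

/-- The transition operator of the simple random walk: the mean of `f` over the neighbours of `u`.
At an isolated vertex the value is `0`, as if the walk died there; a walk from an endpoint of an edge
never reaches such a vertex. -/
noncomputable def nbrAvg (f : V → ℝ) (u : V) : ℝ :=
  (∑ v ∈ G.neighborFinset u, f v) / G.degree u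

variable {G}

lemma nbrAvg_mono {f g : V → ℝ} {u : V} (h : ∀ v, G.Adj u v → f v ≤ g v) :
    nbrAvg G f u ≤ nbrAvg G g u := by
  unfold nbrAvg
  gcongr with v hv
  exact h v (by simpa using hv)

lemma nbrAvg_add (f g : V → ℝ) (u : V) :
    nbrAvg G (fun v => f v + g v) u = nbrAvg G f u + nbrAvg G g u := by
  simp only [nbrAvg, sum_add_distrib, add_div]

lemma nbrAvg_sum {ι : Type*} (s : Finset ι) (f : ι → V → ℝ) (u : V) :
    nbrAvg G (fun v => ∑ i ∈ s, f i v) u = ∑ i ∈ s, nbrAvg G (f i) u := by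
  simp only [nbrAvg, sum_div]
  rw [sum_comm]

lemma nbrAvg_const_mul (c : ℝ) (f : V → ℝ) (u : V) :
    nbrAvg G (fun v => c * f v) u = c * nbrAvg G f u := by
  simp only [nbrAvg, ← mul_sum, mul_div_assoc]

lemma nbrAvg_const (c : ℝ) {u : V} (hu : G.degree u ≠ 0) : nbrAvg G (fun _ => c) u = c := by
  have : (G.degree u : ℝ) ≠ 0 := by exact_mod_cast hu
  simp [nbrAvg, this]

lemma nbrAvg_nonneg {f : V → ℝ} {u : V} (h : ∀ v, G.Adj u v → 0 ≤ f v) : 0 ≤ nbrAvg G f u :=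
  div_nonneg (sum_nonneg fun v hv => h v (by simpa using hv)) (by positivity)

lemma nbrAvg_le_const {f : V → ℝ} {u : V} {c : ℝ} (hc : 0 ≤ c) (h : ∀ v, G.Adj u v → f v ≤ c) :
    nbrAvg G f u ≤ c := by
  by_cases hu : G.degree u = 0
  · simpa [nbrAvg, hu] using hc
  · exact (nbrAvg_mono h).trans (nbrAvg_const c hu).le

lemma ofReal_nbrAvg {f : V → ℝ} {u : V} (hf : ∀ v, 0 ≤ f v) (hu : G.degree u ≠ 0) :
    ENNReal.ofReal (nbrAvg G f u) =
      (∑ v ∈ G.neighborFinset u, ENNReal.ofReal (f v)) / G.degree u := by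
  have : 0 < (G.degree u : ℝ) := by exact_mod_cast Nat.pos_of_ne_zero hu
  rw [nbrAvg, ENNReal.ofReal_div_of_pos this, ENNReal.ofReal_sum_of_nonneg fun v _ => hf v,
    ENNReal.ofReal_natCast]

lemma degree_ne_zero_of_reachable_of_ne {u y : V} (h : G.Reachable u y) (hne : u ≠ y) :
    G.degree u ≠ 0 := by
  obtain ⟨p⟩ := h
  cases p with
  | nil => exact absurd rfl hne
  | cons hadj _ => exact ((G.degree_pos_iff_exists_adj u).2 ⟨_, hadj⟩).ne'

/-! ### Potentials of the graph Laplacian -/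

variable [DecidableEq V]

/-- The range of the symmetric Laplacian is the orthogonal complement of its kernel, and the kernel
consists of the functions that are constant on connected components. -/
lemma exists_lapMatrix_mulVec_eq {x y : V} (h : G.Reachable x y) :
    ∃ f : V → ℝ, G.lapMatrix ℝ *ᵥ f = Pi.single x 1 - Pi.single y 1 := by
  set T := Matrix.toEuclideanLin (G.lapMatrix ℝ) with hT
  have hsym : T.IsSymmetric :=
    Matrix.isSymmetric_toEuclideanLin_iff.2 (G.isHermitian_lapMatrix ℝ)
  have hmem : (WithLp.toLp 2 (Pi.single x 1 - Pi.single y 1 : V → ℝ)) ∈ T.range := by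
    rw [← Submodule.orthogonal_orthogonal T.range, hsym.orthogonal_range,
      Submodule.mem_orthogonal]
    intro z hz
    have hz' : G.lapMatrix ℝ *ᵥ (WithLp.ofLp z) = 0 := by
      have := congrArg WithLp.ofLp (LinearMap.mem_ker.1 hz)
      simpa [hT, Matrix.toEuclideanLin, Matrix.toLpLin_apply] using this
    have hxy := (G.lapMatrix_mulVec_eq_zero_iff_forall_reachable.1 hz') x y h
    simp [PiLp.inner_apply, sub_mul, sum_sub_distrib, hxy]
  obtain ⟨f, hf⟩ := hmem
  refine ⟨WithLp.ofLp f, ?_⟩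
  have := congrArg WithLp.ofLp hf
  simpa [hT, Matrix.toEuclideanLin, Matrix.toLpLin_apply] using this

variable (G) in
open Classical in
/-- A solution of the Poisson equation with a unit source at `x` and a unit sink at `y`, for `x` and
`y` in the same connected component (and `0` otherwise). It is determined up to a constant on every
component, and only its differences within a component are used. -/
noncomputable def potential (x y : V) : V → ℝ :=
  if h : G.Reachable x y then (exists_lapMatrix_mulVec_eq h).choose else 0

lemma lapMatrix_mulVec_potential {x y : V} (h : G.Reachable x y) :
    G.lapMatrix ℝ *ᵥ potential G x y = Pi.single x 1 - Pi.single y 1 := by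
  rw [potential, dif_pos h]
  exact (exists_lapMatrix_mulVec_eq h).choose_spec

variable (G) in
/-- The expected number of visits to `w` of the simple random walk from `u` before it hits `y`, for
`u`, `w` and `y` in the same connected component. By reversibility of the walk this is a multiple of
a difference of potentials, which is taken as the definition. -/
noncomputable def hitVisits (w y u : V) : ℝ :=
  G.degree w * (potential G w y u - potential G w y y)

lemma hitVisits_self (w y : V) : hitVisits G w y y = 0 := by simp [hitVisits]

/-- First-step decomposition of the number of visits. -/
lemma hitVisits_eq {w y u : V} (hw : G.Reachable w y) (hu : G.Reachable u y) (hne : u ≠ y) :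
    hitVisits G w y u = (if u = w then 1 else 0) + nbrAvg G (hitVisits G w y) u := by
  have hd : (G.degree u : ℝ) ≠ 0 := by
    exact_mod_cast degree_ne_zero_of_reachable_of_ne hu hne
  have h := congrFun (lapMatrix_mulVec_potential hw) u
  rw [SimpleGraph.lapMatrix_mulVec_apply] at h
  simp only [Pi.sub_apply, Pi.single_apply, if_neg hne, sub_zero] at h
  have hs : ∑ v ∈ G.neighborFinset u, hitVisits G w y v = G.degree w *
      (∑ v ∈ G.neighborFinset u, potential G w y v - G.degree u * potential G w y y) := by
    simp only [hitVisits, ← mul_sum, sum_sub_distrib, sum_const,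
      SimpleGraph.card_neighborFinset_eq_degree, nsmul_eq_mul]
  rw [nbrAvg, hs]
  field_simp
  rw [hitVisits]
  split_ifs at h ⊢ with huw
  · subst huw
    linear_combination (G.degree u : ℝ) * h
  · linear_combination (G.degree w : ℝ) * h

/-- The minimum principle: off `y` the function is superharmonic, so its minimum over the component
is attained at `y`. -/
lemma hitVisits_nonneg {w y u : V} (hw : G.Reachable w y) (hu : G.Reachable u y) :
    0 ≤ hitVisits G w y u := by
  classical
  obtain ⟨u₀, hu₀, hmin⟩ := exists_min_image (univ.filter fun v => G.Reachable v y)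
    (hitVisits G w y) ⟨y, by simp⟩
  simp only [mem_filter, mem_univ, true_and] at hu₀ hmin
  have key : ∀ (x z : V) (q : G.Walk x z), z = y →
      hitVisits G w y x = hitVisits G w y u₀ → 0 = hitVisits G w y u₀ := by
    intro x z q
    induction q with
    | nil => rintro rfl h; rw [← h, hitVisits_self]
    | @cons a b c hab q ih =>
      rintro rfl h
      by_cases hac : a = c
      · subst hac; rw [← h, hitVisits_self]
      refine ih rfl ?_
      have hac' : G.Reachable a c := hab.reachable.trans q.reachable
      have heq := hitVisits_eq hw hac' hac
      have hd : 0 < (G.degree a : ℝ) := by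
        exact_mod_cast Nat.pos_of_ne_zero (degree_ne_zero_of_reachable_of_ne hac' hac)
      have hle : nbrAvg G (hitVisits G w c) a ≤ hitVisits G w c u₀ := by
        split_ifs at heq <;> linarith
      have hge : ∀ v ∈ G.neighborFinset a, 0 ≤ hitVisits G w c v - hitVisits G w c u₀ := by
        intro v hv
        have hv : G.Adj a v := by simpa using hv
        exact sub_nonneg.2 (hmin v (hv.symm.reachable.trans hac'))
      have hsum : ∑ v ∈ G.neighborFinset a, (hitVisits G w c v - hitVisits G w c u₀) = 0 := by
        refine le_antisymm ?_ (sum_nonneg hge)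
        rw [nbrAvg, div_le_iff₀ hd] at hle
        simp only [sum_sub_distrib, sum_const, SimpleGraph.card_neighborFinset_eq_degree,
          nsmul_eq_mul]
        linarith
      have := (sum_eq_zero_iff_of_nonneg hge).1 hsum b (by simpa using hab)
      linarith
  obtain ⟨q⟩ := hu₀
  rw [key u₀ y q rfl rfl]
  exact hmin u hu

/-- In a round trip along the edge `xy` the expected number of visits to `w` is `deg w` times the
effective resistance between `x` and `y`, and the resistance `r` of an edge is at most `1`: the
energy of the unit flow is `r`, and the edge `xy` alone contributes `r ^ 2` to it. -/
lemma hitVisits_add_hitVisits_le {w x y : V} (hw : G.Reachable w x) (hxy : G.Adj x y) :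
    hitVisits G w y x + hitVisits G w x y ≤ G.degree w := by
  set g := potential G w y - potential G w x with hg
  have hlap : G.lapMatrix ℝ *ᵥ g = Pi.single x 1 - Pi.single y 1 := by
    rw [hg, Matrix.mulVec_sub, lapMatrix_mulVec_potential (hw.trans hxy.reachable),
      lapMatrix_mulVec_potential hw]
    abel
  have hen := G.lapMatrix_toLinearMap₂' ℝ g
  rw [Matrix.toLinearMap₂'_apply', hlap] at hen
  simp only [dotProduct_sub, dotProduct_single, mul_one] at hen
  have hterm : ∀ i j, 0 ≤ if G.Adj i j then (g i - g j) ^ 2 else 0 := by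
    intro i j; split_ifs <;> positivity
  have hx : (g x - g y) ^ 2 ≤ ∑ j, if G.Adj x j then (g x - g j) ^ 2 else 0 := by
    have := single_le_sum (f := fun j => if G.Adj x j then (g x - g j) ^ 2 else 0)
      (fun j _ => hterm x j) (mem_univ y)
    simpa [hxy] using this
  have hy : (g x - g y) ^ 2 ≤ ∑ j, if G.Adj y j then (g y - g j) ^ 2 else 0 := by
    have := single_le_sum (f := fun j => if G.Adj y j then (g y - g j) ^ 2 else 0)
      (fun j _ => hterm y j) (mem_univ x)
    simp only [hxy.symm, if_true] at this
    nlinarith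
  have hpair : ∑ i ∈ {x, y}, (∑ j, if G.Adj i j then (g i - g j) ^ 2 else 0) ≤
      ∑ i, ∑ j, if G.Adj i j then (g i - g j) ^ 2 else 0 :=
    sum_le_sum_of_subset_of_nonneg (subset_univ _) fun i _ _ => sum_nonneg fun j _ => hterm i j
  rw [sum_pair hxy.ne] at hpair
  have hr : g x - g y ≤ 1 := by nlinarith
  have hd : (0 : ℝ) ≤ G.degree w := by positivity
  calc hitVisits G w y x + hitVisits G w x y = G.degree w * (g x - g y) := by
        simp only [hitVisits, hg, Pi.sub_apply]; ring
    _ ≤ G.degree w * 1 := by gcongr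
    _ = G.degree w := mul_one _

/-! ### Walking around a tree -/

variable (G) in
open Classical in
/-- The vertex set of the connected component of `u`. -/
noncomputable def reachSet (u : V) : Finset V := univ.filter (G.Reachable u)

lemma mem_reachSet {u v : V} : v ∈ reachSet G u ↔ G.Reachable u v := by simp [reachSet]

lemma reachSet_eq_of_reachable {u v : V} (h : G.Reachable u v) : reachSet G u = reachSet G v := by
  ext z
  simp only [mem_reachSet]
  exact ⟨h.symm.trans, h.trans⟩

/-- The expected number of visits to `w` of a random walk from the start of `p`, before it has hit
the vertices of `p` one after the other. -/
noncomputable def tourVisits (w : V) : {y z : V} → G.Walk y z → ℝ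
  | _, _, .nil => 0
  | y, _, .cons (v := v) _ p => hitVisits G w v y + tourVisits w p

lemma tourVisits_append (w : V) {x y z : V} (p : G.Walk x y) (q : G.Walk y z) :
    tourVisits w (p.append q) = tourVisits w p + tourVisits w q := by
  induction p with
  | nil => simp [tourVisits]
  | cons h p ih => simp [tourVisits, ih, add_assoc]

lemma tourVisits_nonneg {w y z : V} (p : G.Walk y z) (hw : G.Reachable w y) :
    0 ≤ tourVisits w p := by
  induction p with
  | nil => simp [tourVisits]
  | cons h p ih =>
    have hw' := hw.trans h.reachable
    exact add_nonneg (hitVisits_nonneg hw' h.reachable) (ih hw')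

/-- A closed walk around a subtree with `k + 1` vertices uses each of the `k` edges once in each
direction. The tree is grown by one edge at a time, inserted as a detour. -/
lemma exists_tour (w : V) (k : ℕ) (hk : k + 1 ≤ #(reachSet G w)) :
    ∃ p : G.Walk w w, k + 1 ≤ #p.support.toFinset ∧ tourVisits w p ≤ k * G.degree w := by
  induction k with
  | zero => exact ⟨.nil, by simp, by simp [tourVisits]⟩
  | succ k ih =>
    obtain ⟨p, hp, hcost⟩ := ih (by omega)
    have hd : (0 : ℝ) ≤ G.degree w := by positivity
    by_cases hbig : k + 1 + 1 ≤ #p.support.toFinset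
    · refine ⟨p, hbig, ?_⟩
      push_cast
      nlinarith
    obtain ⟨z, hz, hzp⟩ : ∃ z ∈ reachSet G w, z ∉ p.support.toFinset :=
      exists_mem_notMem_of_card_lt_card (by omega)
    obtain ⟨q⟩ := mem_reachSet.1 hz
    obtain ⟨d, -, hx, hy⟩ := q.exists_boundary_dart {v | v ∈ p.support.toFinset} (by simp) hzp
    have hx : d.fst ∈ p.support := by simpa using hx
    have hy : d.snd ∉ p.support.toFinset := by simpa using hy
    refine ⟨(p.takeUntil _ hx).append (.cons d.adj (.cons d.adj.symm (p.dropUntil _ hx))), ?_, ?_⟩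
    · have hsub : insert d.snd p.support.toFinset ⊆ ((p.takeUntil _ hx).append
          (.cons d.adj (.cons d.adj.symm (p.dropUntil _ hx)))).support.toFinset := by
        intro v hv
        have hsupp : v ∈ p.support ↔ v ∈ (p.takeUntil _ hx).support ∨
            v ∈ (p.dropUntil _ hx).support := by
          rw [← SimpleGraph.Walk.mem_support_append_iff, SimpleGraph.Walk.take_spec]
        simp only [mem_insert, List.mem_toFinset, hsupp] at hv
        simp only [List.mem_toFinset, SimpleGraph.Walk.mem_support_append_iff,
          SimpleGraph.Walk.support_cons, List.mem_cons]
        tauto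
      have := card_le_card hsub
      rw [card_insert_of_notMem hy] at this
      omega
    · have hsplit : tourVisits w p =
          tourVisits w (p.takeUntil _ hx) + tourVisits w (p.dropUntil _ hx) := by
        rw [← tourVisits_append, SimpleGraph.Walk.take_spec]
      have := hitVisits_add_hitVisits_le (p.takeUntil _ hx).reachable d.adj
      rw [tourVisits_append]
      simp only [tourVisits]
      push_cast
      linarith

/-! ### Visits before `N` vertices are seen -/

variable (G) in
/-- The expected reward `∑ r (X s)` that the simple random walk `X` from `u` collects at the times
`s < t` at which the set `A ∪ {X 0, …, X s}` has fewer than `N` elements. -/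
noncomputable def reward (N : ℕ) (r : V → ℝ) : ℕ → Finset V → V → ℝ
  | 0, _, _ => 0
  | t + 1, A, u =>
      if #(insert u A) < N then r u + nbrAvg G (reward N r t (insert u A)) u else 0

variable {N : ℕ} {r : V → ℝ}

lemma reward_nonneg (hr : ∀ v, 0 ≤ r v) (t : ℕ) (A : Finset V) (u : V) :
    0 ≤ reward G N r t A u := by
  induction t generalizing A u with
  | zero => simp [reward]
  | succ t ih =>
    rw [reward]
    split_ifs
    · exact add_nonneg (hr u) (nbrAvg_nonneg fun v _ => ih _ v)
    · rfl

lemma reward_eq_zero_of_le_card (t : ℕ) {A : Finset V} {u : V} (h : N ≤ #(insert u A)) :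
    reward G N r t A u = 0 := by
  cases t with
  | zero => rfl
  | succ t => rw [reward, if_neg (by omega)]

lemma reward_anti (hr : ∀ v, 0 ≤ r v) (t : ℕ) {A B : Finset V} (hAB : A ⊆ B) (u : V) :
    reward G N r t B u ≤ reward G N r t A u := by
  induction t generalizing A B u with
  | zero => rfl
  | succ t ih =>
    by_cases hB : #(insert u B) < N
    · have hsub : insert u A ⊆ insert u B := insert_subset_insert _ hAB
      rw [reward, reward, if_pos hB, if_pos ((card_le_card hsub).trans_lt hB)]
      gcongr
      exact nbrAvg_mono fun v _ => ih hsub v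
    · rw [reward_eq_zero_of_le_card _ (by omega)]
      exact reward_nonneg hr _ _ _

lemma reward_add (r' : V → ℝ) (t : ℕ) (A : Finset V) (u : V) :
    reward G N (fun v => r v + r' v) t A u = reward G N r t A u + reward G N r' t A u := by
  induction t generalizing A u with
  | zero => simp [reward]
  | succ t ih =>
    simp only [reward]
    split_ifs
    · have : reward G N (fun v => r v + r' v) t (insert u A) =
          fun v => reward G N r t (insert u A) v + reward G N r' t (insert u A) v := by
        ext v; exact ih _ v
      rw [this, nbrAvg_add]
      ring
    · simp

/-- If the vertices of a walk `p` complete the visited set to at least `N` elements, then the random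
walk sees `N` vertices no later than when it has hit `y` and then followed the tour `p`. -/
lemma reward_single_le_tour {w y z : V} (p : G.Walk y z) (hw : G.Reachable w y) (t : ℕ)
    (A : Finset V) (u : V) (hu : G.Reachable u y)
    (hN : N ≤ #(insert u A ∪ p.support.toFinset)) :
    reward G N (Pi.single w 1) t A u ≤ hitVisits G w y u + tourVisits w p := by
  -- One stage of the tour: from `u` to `y`, where `c` bounds the visits in all later stages.
  have stage : ∀ (y : V) (S : Finset V) (c : ℝ), G.Reachable w y → 0 ≤ c →
      (∀ t A, N ≤ #(insert y A ∪ S) → reward G N (Pi.single w 1) t A y ≤ c) →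
      ∀ t A u, G.Reachable u y → N ≤ #(insert u A ∪ insert y S) →
        reward G N (Pi.single w 1) t A u ≤ hitVisits G w y u + c := by
    intro y S c hw hc hy t
    induction t with
    | zero =>
      intro A u hu _
      exact add_nonneg (hitVisits_nonneg hw hu) hc
    | succ t ih =>
      intro A u hu hN
      by_cases huy : u = y
      · subst huy
        rw [hitVisits_self, zero_add]
        refine hy _ _ (hN.trans_eq ?_)
        congr 1
        ext v; simp
      by_cases hlt : #(insert u A) < N
      · rw [reward, if_pos hlt, hitVisits_eq hw hu huy, Pi.single_apply, add_assoc]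
        gcongr
        calc nbrAvg G (reward G N (Pi.single w 1) t (insert u A)) u
            ≤ nbrAvg G (fun v => hitVisits G w y v + c) u := by
              refine nbrAvg_mono fun v hv => ih _ v (hv.symm.reachable.trans hu) (hN.trans ?_)
              exact card_le_card (union_subset_union_left (subset_insert _ _))
          _ = nbrAvg G (hitVisits G w y) u + c := by
              rw [nbrAvg_add, nbrAvg_const c (degree_ne_zero_of_reachable_of_ne hu huy)]
      · rw [reward_eq_zero_of_le_card _ (by omega)]
        exact add_nonneg (hitVisits_nonneg hw hu) hc
  induction p generalizing t A u with
  | nil =>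
    refine stage _ ∅ 0 hw le_rfl (fun t A h => ?_) t A u hu (by simpa using hN)
    rw [reward_eq_zero_of_le_card _ (by simpa using h)]
  | @cons y y' z h p ih =>
    have hw' := hw.trans h.reachable
    refine stage y p.support.toFinset _ hw (tourVisits_nonneg _ hw) (fun t A hA => ?_) t A u hu
      (by simpa using hN)
    exact ih hw' t A y h.reachable hA

/-- A walk from `w` returns at most `N * deg w` times before it has seen `N` vertices. -/
lemma reward_single_self_le_degree {w : V} (hN : N ≤ #(reachSet G w)) (t : ℕ) :
    reward G N (Pi.single w 1) t ∅ w ≤ N * G.degree w := by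
  rcases N with _ | k
  · simp [reward_eq_zero_of_le_card]
  obtain ⟨p, hp, hcost⟩ := exists_tour w k hN
  have hd : (0 : ℝ) ≤ G.degree w := by positivity
  have := reward_single_le_tour p (.refl w) t ∅ w (.refl w)
    (hp.trans (card_le_card subset_union_right))
  rw [hitVisits_self] at this
  push_cast
  linarith

/-- At a vertex of degree at least `2 * N` every visit leads with probability at least `1 / 2` to a
vertex that has not been seen, so it is visited at most `2 * N` times before `N` vertices are
seen. -/
lemma reward_single_le_of_two_mul_le_degree {w : V} (hdeg : 2 * N ≤ G.degree w) (t : ℕ)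
    (A : Finset V) (u : V) :
    reward G N (Pi.single w 1) t A u ≤ 2 * ((N - #(insert u A) : ℕ) : ℝ) := by
  induction t generalizing A u with
  | zero => simp only [reward]; positivity
  | succ t ih =>
    by_cases hlt : #(insert u A) < N
    swap
    · rw [reward_eq_zero_of_le_card _ (by omega)]; positivity
    rw [reward, if_pos hlt]
    set B := insert u A with hB
    have hmono : ∀ v, ((N - #(insert v B) : ℕ) : ℝ) ≤ ((N - #B : ℕ) : ℝ) := fun v => by
      exact_mod_cast Nat.sub_le_sub_left (card_le_card (subset_insert v B)) N
    by_cases huw : u = w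
    · subst huw
      have hd : 0 < (G.degree u : ℝ) := by
        have : 0 < G.degree u := by omega
        exact_mod_cast this
      have hbound : ∀ v ∈ G.neighborFinset u, reward G N (Pi.single u 1) t B v ≤
          2 * ((N - #B : ℕ) : ℝ) - 2 * (if v ∉ B then 1 else 0) := by
        intro v _
        refine (ih B v).trans ?_
        by_cases hv : v ∈ B
        · simp [hv]
        · rw [if_pos hv, card_insert_of_notMem hv]
          have : N - #B = (N - (#B + 1)) + 1 := by omega
          rw [this]; push_cast; linarith
      have hnew : (G.degree u : ℝ) ≤
          2 * ∑ v ∈ G.neighborFinset u, if v ∉ B then (1 : ℝ) else 0 := by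
        rw [sum_boole]
        have h1 := card_filter_add_card_filter_not (s := G.neighborFinset u) (p := (· ∈ B))
        have h2 : #{v ∈ G.neighborFinset u | v ∈ B} ≤ #B :=
          card_le_card fun v hv => (mem_filter.1 hv).2
        rw [SimpleGraph.card_neighborFinset_eq_degree] at h1
        have : G.degree u ≤ 2 * #{v ∈ G.neighborFinset u | v ∉ B} := by omega
        exact_mod_cast this
      have hsum := sum_le_sum hbound
      rw [sum_sub_distrib, sum_const, SimpleGraph.card_neighborFinset_eq_degree, nsmul_eq_mul,
        ← mul_sum] at hsum
      rw [Pi.single_eq_same, nbrAvg, ← le_sub_iff_add_le', div_le_iff₀ hd]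
      linarith
    · rw [Pi.single_eq_of_ne huw, zero_add]
      exact nbrAvg_le_const (by positivity) fun v _ => (ih B v).trans (by linarith [hmono v])

lemma reward_single_self_le {w : V} (hN : N ≤ #(reachSet G w)) (t : ℕ) :
    reward G N (Pi.single w 1) t ∅ w ≤ 2 * N ^ 2 := by
  by_cases hdeg : 2 * N ≤ G.degree w
  · refine (reward_single_le_of_two_mul_le_degree hdeg t ∅ w).trans ?_
    have : N - #(insert w (∅ : Finset V)) ≤ N ^ 2 :=
      (Nat.sub_le _ _).trans (Nat.le_self_pow two_ne_zero N)
    exact_mod_cast Nat.mul_le_mul_left 2 this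
  · refine (reward_single_self_le_degree hN t).trans ?_
    have : N * G.degree w ≤ 2 * N ^ 2 := by nlinarith
    exact_mod_cast this

/-- The time spent outside `A`: each of the fewer than `N - #A` new vertices is charged, when it is
first reached, for all later visits to it. -/
lemma reward_compl_le (t : ℕ) (A : Finset V) (u : V) (hN : N ≤ #(reachSet G u)) :
    reward G N (fun v => if v ∈ A then 0 else 1) t A u ≤
      2 * N ^ 2 * ((N - #A : ℕ) : ℝ) := by
  induction t generalizing A u with
  | zero => simp only [reward]; positivity
  | succ t ih =>
    by_cases hlt : #(insert u A) < N
    swap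
    · rw [reward_eq_zero_of_le_card _ (by omega)]; positivity
    have hnbr : ∀ v, G.Adj u v → N ≤ #(reachSet G v) := fun v hv =>
      hN.trans_eq (by rw [reachSet_eq_of_reachable hv.reachable])
    by_cases hu : u ∈ A
    · rw [reward, if_pos hlt, if_pos hu, insert_eq_of_mem hu, zero_add]
      exact nbrAvg_le_const (by positivity) fun v hv => ih A v (hnbr v hv)
    · have hsplit : (fun v => if v ∈ A then (0 : ℝ) else 1) = fun v =>
          (Pi.single u 1 : V → ℝ) v + if v ∈ insert u A then 0 else 1 := by
        ext v
        by_cases hv : v = u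
        · subst hv; simp [hu]
        · simp [hv]
      have hself : reward G N (Pi.single u 1) (t + 1) A u ≤ 2 * N ^ 2 :=
        (reward_anti (fun v => by rw [Pi.single_apply]; split_ifs <;> simp) _
          (empty_subset A) u).trans (reward_single_self_le hN _)
      have hrest : reward G N (fun v => if v ∈ insert u A then 0 else 1) (t + 1) A u ≤
          2 * N ^ 2 * ((N - #(insert u A) : ℕ) : ℝ) := by
        rw [reward, if_pos hlt, if_pos (mem_insert_self _ _), zero_add]
        exact nbrAvg_le_const (by positivity) fun v hv => ih _ v (hnbr v hv)
      rw [hsplit, reward_add]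
      rw [card_insert_of_notMem hu] at hrest hlt
      have : N - #A = (N - (#A + 1)) + 1 := by omega
      rw [this]
      push_cast
      linarith

/-- The expected time until `N` vertices are seen is at most `2 * N ^ 3`. -/
lemma reward_one_le (t : ℕ) (u : V) (hN : N ≤ #(reachSet G u)) :
    reward G N (fun _ => 1) t ∅ u ≤ 2 * N ^ 3 := by
  have := reward_compl_le t ∅ u hN
  simp only [notMem_empty, if_false, card_empty, Nat.sub_zero] at this
  linarith

/-! ### The tail of the number of vertices seen -/

variable (G) in
/-- The expectation of `F (A ∪ {X 0, …, X t})` for the simple random walk `X` from `u`. -/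
noncomputable def visitedExp (F : Finset V → ℝ) : ℕ → Finset V → V → ℝ
  | 0, A, u => F (insert u A)
  | t + 1, A, u => nbrAvg G (visitedExp F t (insert u A)) u

lemma visitedExp_mono {F F' : Finset V → ℝ} {u₀ : V} (t : ℕ) {A : Finset V} {u : V}
    (hu : u ∈ reachSet G u₀) (hA : A ⊆ reachSet G u₀) (h : ∀ B ⊆ reachSet G u₀, F B ≤ F' B) :
    visitedExp G F t A u ≤ visitedExp G F' t A u := by
  induction t generalizing A u with
  | zero => exact h _ (insert_subset hu hA)
  | succ t ih =>
    refine nbrAvg_mono fun v hv => ih ?_ (insert_subset hu hA)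
    exact mem_reachSet.2 ((mem_reachSet.1 hu).trans hv.reachable)

lemma visitedExp_add (F F' : Finset V → ℝ) (t : ℕ) (A : Finset V) (u : V) :
    visitedExp G (fun B => F B + F' B) t A u = visitedExp G F t A u + visitedExp G F' t A u := by
  induction t generalizing A u with
  | zero => rfl
  | succ t ih =>
    simp only [visitedExp]
    rw [← nbrAvg_add]
    congr 1
    ext v; exact ih _ v

lemma visitedExp_sum {ι : Type*} (s : Finset ι) (c : ι → ℝ) (F : ι → Finset V → ℝ) (t : ℕ)
    (A : Finset V) (u : V) :
    visitedExp G (fun B => ∑ i ∈ s, c i * F i B) t A u = ∑ i ∈ s, c i * visitedExp G (F i) t A u := by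
  induction t generalizing A u with
  | zero => rfl
  | succ t ih =>
    simp only [visitedExp]
    simp_rw [← nbrAvg_const_mul]
    rw [← nbrAvg_sum]
    congr 1
    ext v; exact ih _ v

lemma visitedExp_nonneg {F : Finset V → ℝ} (hF : ∀ B, 0 ≤ F B) (t : ℕ) (A : Finset V) (u : V) :
    0 ≤ visitedExp G F t A u := by
  induction t generalizing A u with
  | zero => exact hF _
  | succ t ih => exact nbrAvg_nonneg fun v _ => ih _ v

lemma visitedExp_const_le {c : ℝ} (hc : 0 ≤ c) (t : ℕ) (A : Finset V) (u : V) :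
    visitedExp G (fun _ => c) t A u ≤ c := by
  induction t generalizing A u with
  | zero => rfl
  | succ t ih => exact nbrAvg_le_const hc fun v _ => ih _ v

variable (G) in
/-- The probability that `A` and the first `t` steps of a walk from `u` contain fewer than `N`
vertices. -/
noncomputable def fewProb (N : ℕ) : ℕ → Finset V → V → ℝ :=
  visitedExp G fun B => if #B < N then 1 else 0

lemma fewProb_nonneg (t : ℕ) (A : Finset V) (u : V) : 0 ≤ fewProb G N t A u :=
  visitedExp_nonneg (fun B => by split_ifs <;> simp) t A u

lemma fewProb_le_one (t : ℕ) (A : Finset V) (u : V) : fewProb G N t A u ≤ 1 := by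
  induction t generalizing A u with
  | zero => simp only [fewProb, visitedExp]; split_ifs <;> simp
  | succ t ih => exact nbrAvg_le_const zero_le_one fun v _ => ih _ v

lemma fewProb_eq_zero_of_le_card (t : ℕ) {A : Finset V} {u : V} (h : N ≤ #(insert u A)) :
    fewProb G N t A u = 0 := by
  induction t generalizing A u with
  | zero => simp only [fewProb, visitedExp]; rw [if_neg (by omega)]
  | succ t ih =>
    refine le_antisymm (nbrAvg_le_const le_rfl fun v _ => (ih ?_).le) (fewProb_nonneg _ _ _)
    exact h.trans (card_le_card (subset_insert _ _))

lemma fewProb_anti (t : ℕ) {A B : Finset V} (hAB : A ⊆ B) (u : V) :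
    fewProb G N t B u ≤ fewProb G N t A u := by
  induction t generalizing A B u with
  | zero =>
    have := card_le_card (insert_subset_insert u hAB)
    simp only [fewProb, visitedExp]
    split_ifs <;> first | omega | simp
  | succ t ih => exact nbrAvg_mono fun v _ => ih (insert_subset_insert u hAB) v

/-- Markov's inequality for the time at which `N` vertices are seen. -/
lemma mul_fewProb_le_reward (t : ℕ) (A : Finset V) (u : V) :
    t * fewProb G N t A u ≤ reward G N (fun _ => 1) t A u := by
  induction t generalizing A u with
  | zero => simp [reward]
  | succ t ih =>
    by_cases hlt : #(insert u A) < N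
    · rw [reward, if_pos hlt]
      have h1 : t * fewProb G N (t + 1) A u ≤
          nbrAvg G (reward G N (fun _ => 1) t (insert u A)) u := by
        change t * nbrAvg G (fewProb G N t (insert u A)) u ≤ _
        rw [← nbrAvg_const_mul]
        exact nbrAvg_mono fun v _ => ih _ v
      have h2 := fewProb_le_one (G := G) (N := N) (t + 1) A u
      push_cast
      linarith
    · rw [fewProb_eq_zero_of_le_card _ (by omega), mul_zero]
      exact reward_nonneg (fun _ => zero_le_one) _ _ _

lemma fewProb_le_half (A : Finset V) (u : V) (hN : N ≤ #(reachSet G u)) :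
    fewProb G N (4 * N ^ 3) A u ≤ 1 / 2 := by
  rcases Nat.eq_zero_or_pos N with rfl | hpos
  · rw [fewProb_eq_zero_of_le_card _ (Nat.zero_le _)]; norm_num
  have h := ((mul_fewProb_le_reward (4 * N ^ 3) ∅ u).trans (reward_one_le _ u hN))
  have hpos' : 0 < (N : ℝ) ^ 3 := by positivity
  refine (fewProb_anti _ (empty_subset A) u).trans ?_
  push_cast at h
  by_contra! hcon
  nlinarith

/-- The Markov property: after `s` steps the walk starts afresh. -/
lemma fewProb_add_le {θ : ℝ} {u₀ : V} {t : ℕ} (hθ : ∀ A, ∀ u ∈ reachSet G u₀, fewProb G N t A u ≤ θ)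
    (s : ℕ) (A : Finset V) (u : V) (hu : u ∈ reachSet G u₀) :
    fewProb G N (s + t) A u ≤ θ * fewProb G N s A u := by
  induction s generalizing A u with
  | zero =>
    rw [zero_add]
    by_cases hlt : #(insert u A) < N
    · simpa [fewProb, visitedExp, hlt] using hθ A u hu
    · rw [fewProb_eq_zero_of_le_card _ (by omega), fewProb_eq_zero_of_le_card _ (by omega), mul_zero]
  | succ s ih =>
    rw [Nat.add_right_comm]
    change nbrAvg G (fewProb G N (s + t) (insert u A)) u ≤
      θ * nbrAvg G (fewProb G N s (insert u A)) u
    rw [← nbrAvg_const_mul]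
    exact nbrAvg_mono fun v hv =>
      ih _ v (mem_reachSet.2 ((mem_reachSet.1 hu).trans hv.reachable))

/-- A walk of `k` blocks of `4 * N ^ 3` steps sees fewer than `N` vertices with probability at most
`2 ^ (-k)`. -/
lemma fewProb_le_half_pow {u₀ : V} (hN : N ≤ #(reachSet G u₀)) (k m : ℕ) (A : Finset V) (u : V)
    (hu : u ∈ reachSet G u₀) :
    fewProb G N (m + k * (4 * N ^ 3)) A u ≤ (1 / 2) ^ k := by
  induction k with
  | zero => simpa using fewProb_le_one m A u
  | succ k ih =>
    have h := fewProb_add_le (θ := 1 / 2) (u₀ := u₀) (t := 4 * N ^ 3) (fun A v hv =>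
      fewProb_le_half A v (by rwa [← reachSet_eq_of_reachable (mem_reachSet.1 hv)]))
      (m + k * (4 * N ^ 3)) A u hu
    rw [show m + (k + 1) * (4 * N ^ 3) = m + k * (4 * N ^ 3) + 4 * N ^ 3 by ring,
      pow_succ' (1 / 2 : ℝ)]
    refine h.trans ?_
    gcongr

end

section

variable {V : Type*} [Fintype V] {G : SimpleGraph V} {ρ : ℕ}

/-! ### Measurability -/

instance walkFrom_discreteMeasurableSpace (u : V) : DiscreteMeasurableSpace (WalkFrom G u) where
  forall_measurableSet s := by
    refine MeasurableSpace.measurableSet_iInf.2 fun v => ?_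
    exact MeasurableSpace.measurableSet_top

lemma measurableSet_marginal (i : WalkIndex G ρ) (Q : Finset V → Set (WalkFrom G i.start)) :
    MeasurableSet {x : WalkCollection G ρ | x.2 i ∈ Q x.1} := by
  have : {x : WalkCollection G ρ | x.2 i ∈ Q x.1} =
      ⋃ S : Finset V, {x | x.1 = S} ∩ {x | x.2 i ∈ Q S} := by
    ext x; simp
  rw [this]
  refine MeasurableSet.iUnion fun S => MeasurableSet.inter ?_ ?_
  · exact measurable_fst (measurableSet_singleton S)
  · exact ((measurable_pi_apply i).comp measurable_snd) (MeasurableSet.of_discrete (s := Q S))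


/-! ### The random terminal set -/

variable [DecidableEq V]

lemma sum_terminals_disjoint (p : V → ℝ) (B : Finset V) :
    ∑ S : Finset V, (∏ v, if v ∈ S then p v else 1 - p v) * (if Disjoint B S then 1 else 0) =
      ∏ v ∈ B, (1 - p v) := by
  -- Both sides are the expansion of the product with the factors `p v`, `v ∈ B`, replaced by `0`.
  have h := Finset.prod_add (fun v => if v ∈ B then 0 else p v) (fun v => 1 - p v) univ
  have hl : ∏ v, ((if v ∈ B then 0 else p v) + (1 - p v)) = ∏ v ∈ B, (1 - p v) := by
    rw [← prod_subset (subset_univ B) (fun v _ hv => by simp [hv])]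
    exact prod_congr rfl fun v hv => by simp [hv]
  rw [← hl, h, powerset_univ]
  refine sum_congr rfl fun S _ => ?_
  rw [← prod_mul_prod_compl S (fun v => if v ∈ S then p v else 1 - p v), ← compl_eq_univ_sdiff,
    prod_congr rfl (fun v hv => if_pos hv : ∀ v ∈ S, (if v ∈ S then p v else 1 - p v) = p v),
    prod_congr rfl (fun v hv => if_neg (mem_compl.1 hv) :
      ∀ v ∈ Sᶜ, (if v ∈ S then p v else 1 - p v) = 1 - p v)]
  by_cases hBS : Disjoint B S
  · rw [if_pos hBS, mul_one]
    congr 1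
    exact prod_congr rfl fun v hv => (if_neg (Finset.disjoint_right.1 hBS hv)).symm
  · obtain ⟨v, hvB, hvS⟩ := Finset.not_disjoint_iff.1 hBS
    rw [if_neg hBS, mul_zero, prod_eq_zero (i := v) (f := fun v => if v ∈ B then 0 else p v) hvS
      (if_pos hvB), zero_mul]

lemma terminals_nonneg {p : V → ℝ} (hp : ∀ v, 0 ≤ p v ∧ p v ≤ 1) (S : Finset V) :
    0 ≤ ∏ v, if v ∈ S then p v else 1 - p v := by
  refine prod_nonneg fun v _ => ?_
  split_ifs
  · exact (hp v).1
  · linarith [(hp v).2]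

lemma sum_terminalWeight {p : V → ℝ} (hp : ∀ v, 0 ≤ p v ∧ p v ≤ 1) :
    ∑ S, terminalWeight p S = 1 := by
  unfold terminalWeight
  rw [← ENNReal.ofReal_sum_of_nonneg fun S _ => terminals_nonneg hp S]
  have := sum_terminals_disjoint p ∅
  simp only [disjoint_empty_left, if_true, mul_one, prod_empty] at this
  rw [this, ENNReal.ofReal_one]

/-! ### Marginals of the joint law -/

variable [DecidableRel G.Adj]

lemma shortedWalksLaw_marginal (p : V → ℝ) (L : ℕ) (i : WalkIndex G ρ)
    (Q : Finset V → Set (WalkFrom G i.start)) :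
    shortedWalksLaw G p L ρ {x | x.2 i ∈ Q x.1} =
      ∑ S, terminalWeight p S * (stoppedWalk G S L i.start).toMeasure (Q S) := by
  rw [shortedWalksLaw, Measure.finsetSum_apply]
  refine sum_congr rfl fun S _ => ?_
  rw [Measure.smul_apply, smul_eq_mul, Measure.dirac_prod,
    Measure.map_apply measurable_prodMk_left (measurableSet_marginal i Q)]
  congr 1
  exact (measurePreserving_eval (fun i : WalkIndex G ρ =>
    (stoppedWalk G S L i.start).toMeasure) i).measure_preimage
      (MeasurableSet.of_discrete (s := Q S)).nullMeasurableSet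

lemma shortedWalksLaw_univ {p : V → ℝ} (hp : ∀ v, 0 ≤ p v ∧ p v ≤ 1) (L : ℕ) :
    shortedWalksLaw G p L ρ Set.univ = 1 := by
  rw [shortedWalksLaw, Measure.finsetSum_apply, ← sum_terminalWeight hp]
  refine sum_congr rfl fun S _ => ?_
  rw [Measure.smul_apply, smul_eq_mul, measure_univ, mul_one]

/-! ### Steps of the stopped walk -/

/-- First-step bound: a stopped walk that makes a step moves to a uniform neighbour. -/
lemma toMeasure_stoppedWalk_succ_le (S : Finset V) (L : ℕ) (u : V) (Q : Set (WalkFrom G u))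
    (g : V → ℝ≥0∞) (hnil : u ∈ S ∨ G.degree u = 0 → (⟨u, .nil⟩ : WalkFrom G u) ∉ Q)
    (hstep : ∀ v (hv : G.Adj u v),
      (stoppedWalk G S L v).toMeasure {w | (⟨w.1, .cons hv w.2⟩ : WalkFrom G u) ∈ Q} ≤ g v) :
    (stoppedWalk G S (L + 1) u).toMeasure Q ≤ (∑ v ∈ G.neighborFinset u, g v) / G.degree u := by
  rw [stoppedWalk]
  split_ifs with hS hne
  · rw [PMF.toMeasure_pure_apply _ _ (.of_discrete), if_neg (hnil (.inl hS))]
    exact zero_le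
  · have := hne
    let _ : MeasurableSpace (G.neighborSet u) := ⊤
    rw [PMF.toMeasure_bind_apply _ _ _ .of_discrete, tsum_fintype]
    have hsum : ∑ v ∈ G.neighborFinset u, g v = ∑ v : G.neighborSet u, g v.1 := by
      rw [SimpleGraph.neighborFinset, Set.toFinset, sum_map]; rfl
    rw [hsum, ENNReal.div_eq_inv_mul, mul_sum]
    refine sum_le_sum fun v _ => ?_
    rw [PMF.uniformOfFintype_apply, PMF.toMeasure_map_apply _ _ _ .of_discrete .of_discrete]
    rw [← SimpleGraph.card_neighborSet_eq_degree]
    gcongr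
    exact hstep v.1 v.2
  · have hdeg : G.degree u = 0 := by
      by_contra h
      obtain ⟨v, hv⟩ := (G.degree_pos_iff_exists_adj u).1 (Nat.pos_of_ne_zero h)
      exact hne ⟨⟨v, hv⟩⟩
    rw [PMF.toMeasure_pure_apply _ _ (.of_discrete), if_neg (hnil (.inr hdeg))]
    exact zero_le

/-! ### The probability of missing all terminals -/

/-- The walk stopped at `S` ends outside `S` only if the unstopped walk does not see `S`. -/
lemma toMeasure_stoppedWalk_le_visitedExp (S : Finset V) (L : ℕ) {A : Finset V} {u : V}
    (hA : Disjoint A S) (hu : G.degree u ≠ 0) :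
    (stoppedWalk G S L u).toMeasure {w | w.1 ∉ S} ≤
      ENNReal.ofReal (visitedExp G (fun B => if Disjoint B S then 1 else 0) L A u) := by
  have hχ : ∀ B : Finset V, (0 : ℝ) ≤ if Disjoint B S then 1 else 0 := fun B => by
    split_ifs <;> simp
  induction L generalizing A u with
  | zero =>
    rw [stoppedWalk, PMF.toMeasure_pure_apply _ _ .of_discrete]
    by_cases huS : u ∈ S
    · simp [huS]
    · simp [huS, visitedExp, hA]
  | succ L ih =>
    by_cases huS : u ∈ S
    · rw [stoppedWalk, if_pos huS, PMF.toMeasure_pure_apply _ _ .of_discrete, if_neg (by simpa)]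
      exact zero_le
    rw [visitedExp, ofReal_nbrAvg (fun v => visitedExp_nonneg hχ _ _ _) hu]
    refine toMeasure_stoppedWalk_succ_le S L u _ _ (fun h => absurd h (by tauto)) fun v hv => ?_
    refine ih (disjoint_insert_left.2 ⟨huS, hA⟩) ?_
    exact ((G.degree_pos_iff_exists_adj v).2 ⟨u, hv.symm⟩).ne'

/-- A walk misses a terminal in its component only if it sees few vertices, or if it sees `N`
vertices none of which is a terminal. -/
lemma shortedWalksLaw_not_endsAtTerminal_le {p : V → ℝ} {β : ℝ} (hβ : 0 ≤ β)
    (hp : ∀ v, β ≤ p v ∧ p v ≤ 1) {L N k : ℕ} (hL : k * (4 * N ^ 3) ≤ L) (i : WalkIndex G ρ) :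
    shortedWalksLaw G p L ρ {x | ¬ EndsAtTerminal x i} ≤
      ENNReal.ofReal ((1 - β) ^ N + (1 / 2) ^ k) := by
  set u := i.start with hu
  have hdeg : G.degree u ≠ 0 := ((G.degree_pos_iff_exists_adj u).2 ⟨i.1.snd, i.1.adj⟩).ne'
  have hp0 : ∀ v, 0 ≤ p v ∧ p v ≤ 1 := fun v => ⟨hβ.trans (hp v).1, (hp v).2⟩
  have hβ1 : 0 ≤ 1 - β := by linarith [(hp u).1, (hp u).2]
  have hw := terminals_nonneg hp0
  set C := reachSet G u with hC
  set M := min N #C with hM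
  set wt : Finset V → ℝ := fun S =>
    (∏ v, if v ∈ S then p v else 1 - p v) * if Disjoint C S then 0 else 1 with hwt
  have hwt0 : ∀ S, 0 ≤ wt S := fun S => mul_nonneg (hw S) (by split_ifs <;> simp)
  have hχ : ∀ B S : Finset V, (0 : ℝ) ≤ if Disjoint B S then 1 else 0 := fun B S => by
    split_ifs <;> simp
  have hset : {x : WalkCollection G ρ | ¬ EndsAtTerminal x i} =
      {x | x.2 i ∈ {w : WalkFrom G u | ¬ Disjoint C x.1 ∧ w.1 ∉ x.1}} := by
    ext x
    simp only [EndsAtTerminal, Set.mem_ofPred_eq, Finset.not_disjoint_iff, hC, mem_reachSet,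
      Classical.not_imp]
    refine and_congr_left fun _ => exists_congr fun t => and_comm
  -- The left side is the probability that `C` contains a terminal but the set `B` seen does not. It
  -- vanishes for `B = C`.
  have hF : ∀ B ⊆ C, ∑ S, wt S * (if Disjoint B S then 1 else 0) ≤
      (1 - β) ^ N + if #B < M then 1 else 0 := by
    intro B hBC
    have hle : ∑ S, wt S * (if Disjoint B S then 1 else 0) ≤ ∏ v ∈ B, (1 - p v) := by
      rw [← sum_terminals_disjoint]
      refine sum_le_sum fun S _ => mul_le_mul_of_nonneg_right ?_ (hχ B S)
      exact mul_le_of_le_one_right (hw S) (by split_ifs <;> simp)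
    have hprod : ∏ v ∈ B, (1 - p v) ≤ (1 - β) ^ #B :=
      (prod_le_prod (fun v _ => by linarith [(hp v).2]) fun v _ => by linarith [(hp v).1]).trans_eq
        (prod_const _)
    have hpow0 : 0 ≤ (1 - β) ^ N := pow_nonneg hβ1 _
    have hβ2 : 1 - β ≤ 1 := by linarith
    by_cases hB : #B < M
    · rw [if_pos hB]
      linarith [pow_le_one₀ hβ1 hβ2 (n := #B)]
    rw [if_neg hB, add_zero]
    by_cases hN : N ≤ #B
    · exact (hle.trans hprod).trans (pow_le_pow_of_le_one hβ1 hβ2 hN)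
    · have hBeq : B = C := eq_of_subset_of_card_le hBC (by omega)
      refine (sum_eq_zero fun S _ => ?_).trans_le hpow0
      rw [hBeq, hwt]
      by_cases h : Disjoint C S <;> simp [h]
  have hfew : fewProb G M L ∅ u ≤ (1 / 2) ^ k := by
    have hML : k * (4 * M ^ 3) ≤ L :=
      (Nat.mul_le_mul_left _ (by gcongr; exact min_le_left _ _)).trans hL
    have := fewProb_le_half_pow (min_le_right N #C) k (L - k * (4 * M ^ 3)) ∅ u
      (mem_reachSet.2 (.refl u))
    rwa [Nat.sub_add_cancel hML] at this
  rw [hset]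
  refine (shortedWalksLaw_marginal p L i
    (fun S => {w : WalkFrom G u | ¬ Disjoint C S ∧ w.1 ∉ S})).trans_le ?_
  calc ∑ S, terminalWeight p S *
        (stoppedWalk G S L u).toMeasure {w | ¬ Disjoint C S ∧ w.1 ∉ S}
      ≤ ∑ S, ENNReal.ofReal
          (wt S * visitedExp G (fun B => if Disjoint B S then 1 else 0) L ∅ u) := by
        refine sum_le_sum fun S _ => ?_
        by_cases h : Disjoint C S
        · simp [h]
        rw [ENNReal.ofReal_mul (hwt0 S)]
        simp only [hwt, h, not_false_eq_true, true_and, if_false, mul_one]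
        rw [terminalWeight]
        gcongr
        exact toMeasure_stoppedWalk_le_visitedExp S L (Finset.disjoint_empty_left S) hdeg
    _ = ENNReal.ofReal
          (visitedExp G (fun B => ∑ S, wt S * if Disjoint B S then 1 else 0) L ∅ u) := by
        rw [← ENNReal.ofReal_sum_of_nonneg fun S _ =>
          mul_nonneg (hwt0 S) (visitedExp_nonneg (fun B => hχ B S) _ _ _), visitedExp_sum]
    _ ≤ ENNReal.ofReal ((1 - β) ^ N + (1 / 2) ^ k) := by
        refine ENNReal.ofReal_le_ofReal ?_
        refine (visitedExp_mono L (mem_reachSet.2 (.refl u)) (empty_subset _) hF).trans ?_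
        rw [visitedExp_add]
        exact add_le_add (visitedExp_const_le (pow_nonneg hβ1 _) _ _ _) hfew

/-! ### The expected load -/

/-- The degrees are a stationary measure of the walk: started with `deg u` walks at every vertex
`u`, at most two walks are expected to cross the edge `e` in each step, one in each direction. -/
lemma sum_degree_mul_crossing_le (S : Finset V) (L : ℕ) (e : Sym2 V) :
    ∑ u, (G.degree u : ℝ≥0∞) * (stoppedWalk G S L u).toMeasure {w | e ∈ w.2.edges} ≤ 2 * L := by
  classical
  induction L with
  | zero =>
    refine (sum_eq_zero fun u _ => ?_).trans_le zero_le
    rw [stoppedWalk, PMF.toMeasure_pure_apply _ _ .of_discrete]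
    simp
  | succ L ih =>
    set a : V → ℝ≥0∞ := fun v => (stoppedWalk G S L v).toMeasure {w | e ∈ w.2.edges} with ha
    have hstep : ∀ u, (G.degree u : ℝ≥0∞) *
        (stoppedWalk G S (L + 1) u).toMeasure {w | e ∈ w.2.edges} ≤
        ∑ v ∈ G.neighborFinset u, ((if s(u, v) = e then 1 else 0) + a v) := by
      intro u
      have hnbr : ∀ v (hv : G.Adj u v), (stoppedWalk G S L v).toMeasure
          {w | (⟨w.1, .cons hv w.2⟩ : WalkFrom G u) ∈ {w : WalkFrom G u | e ∈ w.2.edges}} ≤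
          (if s(u, v) = e then 1 else 0) + a v := by
        intro v hv
        by_cases he : s(u, v) = e
        · rw [if_pos he]
          exact prob_le_one.trans le_self_add
        · rw [if_neg he, zero_add]
          refine measure_mono fun w hw => ?_
          simpa [Ne.symm he] using hw
      calc (G.degree u : ℝ≥0∞) * (stoppedWalk G S (L + 1) u).toMeasure {w | e ∈ w.2.edges}
          ≤ G.degree u * ((∑ v ∈ G.neighborFinset u, ((if s(u, v) = e then 1 else 0) + a v)) /
              G.degree u) := by
            gcongr
            exact toMeasure_stoppedWalk_succ_le S L u _ _ (by simp) hnbr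
        _ ≤ _ := ENNReal.mul_div_le
    have hcross : ∑ u, ∑ v ∈ G.neighborFinset u, (if s(u, v) = e then (1 : ℝ≥0∞) else 0) ≤ 2 := by
      induction e with
      | _ x y =>
      calc ∑ u, ∑ v ∈ G.neighborFinset u, (if s(u, v) = s(x, y) then (1 : ℝ≥0∞) else 0)
          ≤ ∑ u, ∑ v, ((if u = x then if v = y then (1 : ℝ≥0∞) else 0 else 0) +
              (if u = y then if v = x then (1 : ℝ≥0∞) else 0 else 0)) := by
            refine sum_le_sum fun u _ => (sum_le_sum_of_subset (subset_univ _)).trans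
              (sum_le_sum fun v _ => ?_)
            by_cases h : s(u, v) = s(x, y)
            · rw [if_pos h]
              rcases Sym2.eq_iff.1 h with ⟨rfl, rfl⟩ | ⟨rfl, rfl⟩
              · simp
              · simp
            · simp [h]
        _ = 2 := by
            simp only [sum_add_distrib, sum_ite_irrel, sum_ite_eq', mem_univ, if_true,
              sum_const_zero]
            norm_num
    have hswap : ∑ u, ∑ v ∈ G.neighborFinset u, a v = ∑ v, (G.degree v : ℝ≥0∞) * a v := by
      rw [sum_comm' (t' := univ) (s' := fun v => G.neighborFinset v)
        (by intro u v; simp [G.adj_comm])]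
      refine sum_congr rfl fun v _ => ?_
      rw [sum_const, SimpleGraph.card_neighborFinset_eq_degree, nsmul_eq_mul]
    refine (sum_le_sum fun u _ => hstep u).trans ?_
    simp only [sum_add_distrib]
    rw [hswap]
    calc _ ≤ (2 : ℝ≥0∞) + 2 * L := add_le_add hcross ih
      _ = 2 * (L + 1 : ℕ) := by push_cast; ring

lemma sum_walkIndex_start (f : V → ℝ≥0∞) :
    ∑ i : WalkIndex G ρ, f i.start = ρ * ∑ u, (G.degree u : ℝ≥0∞) * f u := by
  rw [Fintype.sum_prod_type]
  simp only [WalkIndex.start, sum_const, card_univ, Fintype.card_fin, nsmul_eq_mul, ← mul_sum]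
  congr 1
  rw [← sum_fiberwise univ (fun d : G.Dart => d.fst)]
  refine sum_congr rfl fun u _ => ?_
  rw [sum_congr rfl (g := fun _ => f u) (fun d hd => by rw [(mem_filter.1 hd).2]), sum_const,
    nsmul_eq_mul, G.dart_fst_fiber_card_eq_degree u]

lemma lintegral_load_le {p : V → ℝ} (hp : ∀ v, 0 ≤ p v ∧ p v ≤ 1) (L : ℕ) (e : Sym2 V) :
    ∫⁻ x, (load x e : ℝ≥0∞) ∂(shortedWalksLaw G p L ρ) ≤ 2 * ρ * L := by
  classical
  have hload : ∀ x : WalkCollection G ρ, (load x e : ℝ≥0∞) =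
      ∑ i, {x : WalkCollection G ρ | x.2 i ∈ {w | e ∈ w.2.edges}}.indicator 1 x := by
    intro x
    rw [load, ← sum_boole]
    exact sum_congr rfl fun i _ => by simp [Set.indicator_apply]
  have hmeas : ∀ i : WalkIndex G ρ,
      MeasurableSet {x : WalkCollection G ρ | x.2 i ∈ {w | e ∈ w.2.edges}} := fun i =>
    measurableSet_marginal i fun _ => _
  simp_rw [hload]
  rw [lintegral_finsetSum _ fun i _ => measurable_one.indicator (hmeas i)]
  calc _ = ∑ i : WalkIndex G ρ, ∑ S, terminalWeight p S *
          (stoppedWalk G S L i.start).toMeasure {w | e ∈ w.2.edges} := by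
        refine sum_congr rfl fun i _ => ?_
        rw [lintegral_indicator_one (hmeas i)]
        exact shortedWalksLaw_marginal p L i fun _ => {w | e ∈ w.2.edges}
    _ = ∑ S, terminalWeight p S * (ρ * ∑ u, (G.degree u : ℝ≥0∞) *
          (stoppedWalk G S L u).toMeasure {w | e ∈ w.2.edges}) := by
        rw [sum_comm]
        refine sum_congr rfl fun S _ => ?_
        rw [← mul_sum, sum_walkIndex_start (G := G) fun u =>
          (stoppedWalk G S L u).toMeasure {w | e ∈ w.2.edges}]
    _ ≤ ∑ S, terminalWeight p S * (ρ * (2 * L)) := by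
        gcongr with S _
        exact sum_degree_mul_crossing_le (G := G) S L e
    _ = 2 * ρ * L := by
        rw [← sum_mul, sum_terminalWeight hp]
        ring

end

/-! ### Choice of the parameters -/

lemma half_le_log {n : ℝ} (hn : 2 ≤ n) : 1 / 2 ≤ Real.log n := by
  have h1 := Real.log_two_gt_d9
  have h2 := Real.log_le_log (by norm_num) hn
  linarith

/-- With `N` of order `log n / β` and `k` of order `log n`, both sources of failure have probability
at most `n ^ (-(d + 1))`, and `k` blocks of `4 * N ^ 3` steps fit into a walk of length
`O(β⁻³ log⁴ n)`. -/
lemma exists_block_parameters {d β n L : ℝ} (hd : 0 < d) (hβ : 0 < β) (hβ1 : β < 1) (hn : 2 ≤ n)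
    (hL : 8 * (d + 2) * (d + 3) ^ 3 * (β⁻¹ ^ 3 * Real.log n ^ 4) ≤ L) :
    ∃ N k : ℕ, ((k * (4 * N ^ 3) : ℕ) : ℝ) ≤ L ∧ (1 - β) ^ N + (1 / 2) ^ k ≤ n ^ (-d) := by
  have hn0 : 0 < n := by linarith
  set ℓ := Real.log n with hℓ
  have hℓ2 : 1 / 2 ≤ ℓ := half_le_log hn
  have hexp : Real.exp ℓ = n := Real.exp_log hn0
  have hβi : 1 ≤ β⁻¹ := (one_le_inv₀ hβ).2 hβ1.le
  have hℓβ : ℓ ≤ ℓ * β⁻¹ := le_mul_of_one_le_right (by linarith) hβi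
  set N := ⌈(d + 1) * (ℓ * β⁻¹)⌉₊ with hN
  set k := ⌈2 * (d + 1) * ℓ⌉₊ with hk
  have hNlow : (d + 1) * (ℓ * β⁻¹) ≤ N := Nat.le_ceil _
  have hklow : 2 * (d + 1) * ℓ ≤ k := Nat.le_ceil _
  have hNup : (N : ℝ) ≤ (d + 3) * (ℓ * β⁻¹) := by
    have := Nat.ceil_lt_add_one (a := (d + 1) * (ℓ * β⁻¹)) (by positivity)
    linarith
  have hkup : (k : ℝ) ≤ 2 * (d + 2) * ℓ := by
    have := Nat.ceil_lt_add_one (a := 2 * (d + 1) * ℓ) (by positivity)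
    linarith
  refine ⟨N, k, ?_, ?_⟩
  · push_cast
    calc (k : ℝ) * (4 * (N : ℝ) ^ 3)
        ≤ 2 * (d + 2) * ℓ * (4 * ((d + 3) * (ℓ * β⁻¹)) ^ 3) := by gcongr
      _ = 8 * (d + 2) * (d + 3) ^ 3 * (β⁻¹ ^ 3 * ℓ ^ 4) := by ring
      _ ≤ L := hL
  · have h1 : (1 - β) ^ N ≤ Real.exp (-((d + 1) * ℓ)) := by
      calc (1 - β) ^ N ≤ Real.exp (-β) ^ N := by
            have : 0 ≤ 1 - β := by linarith
            gcongr
            exact Real.one_sub_le_exp_neg β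
        _ = Real.exp (-(N * β)) := by rw [← Real.exp_nat_mul]; ring_nf
        _ ≤ _ := by
            refine Real.exp_le_exp.2 (neg_le_neg ?_)
            calc (d + 1) * ℓ = (d + 1) * (ℓ * β⁻¹) * β := by field_simp
              _ ≤ N * β := by gcongr
    have h2 : (1 / 2 : ℝ) ^ k ≤ Real.exp (-((d + 1) * ℓ)) := by
      calc (1 / 2 : ℝ) ^ k ≤ Real.exp (-(1 / 2)) ^ k := by
            gcongr
            linarith [Real.one_sub_le_exp_neg (1 / 2)]
        _ = Real.exp (-(k / 2)) := by rw [← Real.exp_nat_mul]; ring_nf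
        _ ≤ _ := by gcongr; linarith
    have h3 : n ^ (-d) = n * Real.exp (-((d + 1) * ℓ)) := by
      rw [Real.rpow_def_of_pos hn0, ← hℓ]
      nth_rw 1 [← hexp]
      rw [← Real.exp_add]
      ring_nf
    rw [h3]
    nlinarith [Real.exp_pos (-((d + 1) * ℓ))]

section

variable {V : Type*} [Fintype V] {G : SimpleGraph V} {ρ : ℕ}

lemma two_le_numVerts (i : WalkIndex G ρ) : 2 ≤ numVerts V := by
  have : 1 < Fintype.card V := Fintype.one_lt_card_iff.2 ⟨_, _, i.1.adj.ne⟩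
  unfold numVerts
  exact_mod_cast this

/-- There are at most `n ^ 2` darts, hence polynomially many walks if `ε` is not too small. -/
lemma card_walkIndex_le [DecidableEq V] [DecidableRel G.Adj] {a R ε : ℝ} (hR : 0 < R) (hε : 0 < ε)
    (hn : 2 ≤ numVerts V)
    (hρ : ρ ≤ R * (Real.log (numVerts V) * ε⁻¹ ^ 2)) (hεn : numVerts V ^ (-a) ≤ ε) :
    (Fintype.card (WalkIndex G ρ) : ℝ) ≤ numVerts V ^ (2 * a + 3 + 2 * R) := by
  have hdart : Fintype.card G.Dart ≤ Fintype.card V ^ 2 := by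
    have := Fintype.card_le_of_injective _ (SimpleGraph.Dart.toProd_injective (G := G))
    rwa [Fintype.card_prod, ← sq] at this
  have hdart' : (Fintype.card G.Dart : ℝ) ≤ numVerts V ^ 2 := by
    unfold numVerts; exact_mod_cast hdart
  set n := numVerts V
  have hn0 : 0 < n := by linarith
  have hεi : ε⁻¹ ≤ n ^ a := by
    rw [Real.rpow_neg hn0.le] at hεn
    exact inv_le_of_inv_le₀ (by positivity) hεn
  have hRn : R ≤ n ^ (2 * R) := by
    rw [Real.rpow_def_of_pos hn0]
    have h1 := Real.add_one_le_exp (Real.log n * (2 * R))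
    have h2 := mul_le_mul_of_nonneg_right (half_le_log hn) (by positivity : 0 ≤ 2 * R)
    linarith
  have hlog : 0 ≤ Real.log n := by linarith [half_le_log hn]
  rw [Fintype.card_prod, Fintype.card_fin]
  push_cast
  calc (Fintype.card G.Dart : ℝ) * ρ ≤ n ^ 2 * (R * (Real.log n * ε⁻¹ ^ 2)) := by gcongr
    _ ≤ n ^ 2 * (n ^ (2 * R) * (n * (n ^ a) ^ 2)) := by
        gcongr
        exact Real.log_le_self hn0.le
    _ = n ^ (2 * a + 3 + 2 * R) := by
        rw [← Real.rpow_natCast (n ^ a), ← Real.rpow_mul hn0.le, Real.rpow_add hn0,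
          Real.rpow_add hn0]
        norm_num
        ring_nf

/-- A lower bound on the probability of an event from an upper bound on its complement. -/
lemma ofReal_one_sub_le_measure {α : Type*} [MeasurableSpace α] {μ : Measure α} (hμ : μ Set.univ = 1)
    {s : Set α} {q : ℝ} (hq : 0 ≤ q) (hs : μ sᶜ ≤ ENNReal.ofReal q) :
    ENNReal.ofReal (1 - q) ≤ μ s := by
  rw [ENNReal.ofReal_sub _ hq, ENNReal.ofReal_one, tsub_le_iff_right, ← hμ]
  calc μ Set.univ = μ (s ∪ sᶜ) := by rw [Set.union_compl_self]
    _ ≤ μ s + μ sᶜ := measure_union_le _ _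
    _ ≤ μ s + ENNReal.ofReal q := by gcongr

end

end ShortedWalks

open ShortedWalks in
theorem mainTheorem6 :
    (∀ c > (0 : ℝ), ∀ δ > (0 : ℝ), ∀ a > (0 : ℝ), ∀ R > (0 : ℝ), ∃ K > (0 : ℝ),
      ∀ (V : Type u) [Fintype V] [DecidableEq V] (G : SimpleGraph V) [DecidableRel G.Adj]
        (β ε : ℝ) (p : V → ℝ) (L ρ : ℕ),
        0 < β → β < 1 → 0 < ε → c * Real.log (numVerts V) ≤ β * numVerts V →
        (∀ v, β ≤ p v ∧ p v ≤ 1) →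
        K * (β⁻¹ ^ 3 * Real.log (numVerts V) ^ 4) ≤ L →
        ρ ≤ R * (Real.log (numVerts V) * ε⁻¹ ^ 2) →
        (∀ i : WalkIndex G ρ,
          ENNReal.ofReal (1 - numVerts V ^ (-δ)) ≤
            shortedWalksLaw G p L ρ {x | EndsAtTerminal x i}) ∧
        (numVerts V ^ (-a) ≤ ε →
          ENNReal.ofReal (1 - numVerts V ^ (-δ)) ≤
            shortedWalksLaw G p L ρ {x | ∀ i : WalkIndex G ρ, EndsAtTerminal x i})) ∧
    (∀ c > (0 : ℝ), ∀ K > (0 : ℝ), ∀ R > (0 : ℝ), ∃ C > (0 : ℝ),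
      ∀ (V : Type u) [Fintype V] [DecidableEq V] (G : SimpleGraph V) [DecidableRel G.Adj]
        (β ε : ℝ) (p : V → ℝ) (L ρ : ℕ),
        0 < β → β < 1 → 0 < ε → c * Real.log (numVerts V) ≤ β * numVerts V →
        (∀ v, β ≤ p v ∧ p v ≤ 1) →
        L ≤ K * (β⁻¹ ^ 3 * Real.log (numVerts V) ^ 4) →
        ρ ≤ R * (Real.log (numVerts V) * ε⁻¹ ^ 2) →
        ∀ e ∈ G.edgeSet,
          ∫⁻ x, (load x e : ℝ≥0∞) ∂(shortedWalksLaw G p L ρ) ≤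
            ENNReal.ofReal (C * (β⁻¹ ^ 3 * Real.log (numVerts V) ^ 5 * ε⁻¹ ^ 2))) := by
  constructor
  · intro c _ δ hδ a ha R hR
    -- The failure probability `n ^ (-d)` of one walk survives the union bound over all walks.
    set d := δ + (2 * a + 3 + 2 * R) with hd
    have hd0 : 0 < d := by positivity
    refine ⟨8 * (d + 2) * (d + 3) ^ 3, by positivity, ?_⟩
    intro V _ _ G _ β ε p L ρ hβ hβ1 hε _ hp hL hρ
    have hn0 : 0 ≤ numVerts V := Nat.cast_nonneg _
    have huniv := shortedWalksLaw_univ (G := G) (ρ := ρ)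
      (fun v => ⟨hβ.le.trans (hp v).1, (hp v).2⟩ : ∀ v, 0 ≤ p v ∧ p v ≤ 1) L
    have hfail : ∀ i : WalkIndex G ρ, shortedWalksLaw G p L ρ {x | ¬ EndsAtTerminal x i} ≤
        ENNReal.ofReal (numVerts V ^ (-d)) := by
      intro i
      obtain ⟨N, k, hNk, hsum⟩ := exists_block_parameters hd0 hβ hβ1 (two_le_numVerts i) hL
      exact (shortedWalksLaw_not_endsAtTerminal_le hβ.le hp (by exact_mod_cast hNk) i).trans
        (ENNReal.ofReal_le_ofReal hsum)
    refine ⟨fun i => ofReal_one_sub_le_measure huniv (by positivity) ?_, fun hεn =>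
      ofReal_one_sub_le_measure huniv (by positivity) ?_⟩
    · refine (hfail i).trans (ENNReal.ofReal_le_ofReal ?_)
      refine Real.rpow_le_rpow_of_exponent_le (by linarith [two_le_numVerts i]) ?_
      rw [hd]
      linarith
    · have hset : {x : WalkCollection G ρ | ∀ i, EndsAtTerminal x i}ᶜ =
          ⋃ i, {x | ¬ EndsAtTerminal x i} := by
        ext x; simp
      rw [hset]
      rcases isEmpty_or_nonempty (WalkIndex G ρ) with hempty | ⟨⟨i₀⟩⟩
      · simp
      have hn := two_le_numVerts i₀
      have hn0 : 0 < numVerts V := by linarith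
      refine (measure_iUnion_fintype_le _ _).trans ((Finset.sum_le_sum fun i _ => hfail i).trans ?_)
      rw [Finset.sum_const, Finset.card_univ, nsmul_eq_mul, ← ENNReal.ofReal_natCast,
        ← ENNReal.ofReal_mul (Nat.cast_nonneg _)]
      refine ENNReal.ofReal_le_ofReal ?_
      calc (Fintype.card (WalkIndex G ρ) : ℝ) * numVerts V ^ (-d)
          ≤ numVerts V ^ (2 * a + 3 + 2 * R) * numVerts V ^ (-d) := by
            gcongr
            exact card_walkIndex_le hR hε hn hρ hεn
        _ = numVerts V ^ (-δ) := by
            rw [← Real.rpow_add hn0, hd]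
            ring_nf
  · intro c _ K hK R hR
    refine ⟨2 * R * K, by positivity, ?_⟩
    intro V _ _ G _ β ε p L ρ hβ _ hε _ hp hL hρ e _
    refine (lintegral_load_le (fun v => ⟨hβ.le.trans (hp v).1, (hp v).2⟩) L e).trans ?_
    have hcast : (2 * ρ * L : ℝ≥0∞) = ENNReal.ofReal (2 * (ρ * L)) := by
      rw [ENNReal.ofReal_mul (by norm_num), ENNReal.ofReal_mul (Nat.cast_nonneg _)]
      simp [mul_assoc]
    rw [hcast]
    refine ENNReal.ofReal_le_ofReal ?_
    have := mul_le_mul hρ hL (Nat.cast_nonneg _) ((Nat.cast_nonneg _).trans hρ)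
    calc 2 * ((ρ : ℝ) * L) ≤ 2 * (R * (Real.log (numVerts V) * ε⁻¹ ^ 2) *
          (K * (β⁻¹ ^ 3 * Real.log (numVerts V) ^ 4))) := by gcongr
      _ = _ := by ring
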